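/- An alphabet is a finite set of letters, numbered $1,\dots,p$. For a word $w$ over an alphabet $\Sigma$ with $p$ letters, $\Pi(w)\in\mathbb{N}^p$ is its Parikh vector (the number of occurrences of each letter), and $\Pi(L)=\{\Pi(w) : w\in L\}$ for a language $L$. An elementary bounded language over $\Sigma$ is a language of the form $w_1^*w_2^*\cdots w_k^*$ with words $w_1,\dots,w_k\in\Sigma^*$. A substitution from $\Sigma$ to an alphabet $\Delta$ is a map $\sigma$ from $\Sigma^*$ to languages over $\Delta$ with $\sigma(\varepsilon)=\{\varepsilon\}$ and $\sigma(uv)=\sigma(u)\cdot\sigma(v)$; put $\sigma(L)=\bigcup_{w\in L}\sigma(w)$. Proposition. Let $\Sigma$ and $\Delta$ be alphabets (possibly equal), and let 1. $L$ be a context-free language over $\Sigma$; 2. $B$ be an elementary bounded language over $\Sigma$ with $\Pi(L\cap B)=\Pi(L)$; 3. $\sigma$ and $\tau$ be substitutions from $\Sigma$ to $\Delta$ such that for each letter $a\in\Sigma$ the language $\sigma(a)$ is context-free, $\tau(a)$ is elementary bounded, and $\Pi(\sigma(a)\cap\tau(a))=\Pi(\sigma(a))$. Then there is an effectively computable elementary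 bounded language $B'$ over $\Delta$ with $\Pi(\sigma(L)\cap B')=\Pi(\sigma(L))$. More precisely, there is a single total computable function which, given the sizes of $\Sigma$ and $\Delta$, a context-free grammar generating $L$, words $w_1,\dots,w_k$ with $B=w_1^*\cdots w_k^*$, and for each letter $a\in\Sigma$ a context-free grammar generating $\sigma(a)$ and words $v_1,\dots,v_m$ with $\tau(a)=v_1^*\cdots v_m^*$, returns words $u_1,\dots,u_r\in\Delta^*$ such that $B'=u_1^*\cdots u_r^*$ has this property whenever the hypotheses above hold. -/

import Mathlib

/-! ### Context-free grammars as finite data -/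

/-- A context-free grammar over the terminal alphabet `α`, written as finite data: the initial
variable and the list of productions `(X, w)`. Variables are natural numbers (only the finitely many
that occur matter); in `w`, `Sum.inl a` is the terminal `a` and `Sum.inr X` is the variable `X`. -/
abbrev GrammarCode (α : Type) : Type := ℕ × List (ℕ × List (α ⊕ ℕ))

namespace GrammarCode

/-- A letter of a right-hand side as a grammar symbol. -/
def toSymbol {α : Type} : α ⊕ ℕ → Symbol α ℕ
  | Sum.inl a => Symbol.terminal a
  | Sum.inr X => Symbol.nonterminal X

/-- The finite set of rewriting rules listed by a code. -/
def ruleSet {α : Type} [DecidableEq α] (g : GrammarCode α) : Finset (ContextFreeRule α ℕ) :=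
  (g.2.map fun r => (⟨r.1, r.2.map toSymbol⟩ : ContextFreeRule α ℕ)).toFinset

/-- The context-free grammar written down by a code. -/
def toCFG {α : Type} [DecidableEq α] (g : GrammarCode α) : ContextFreeGrammar α where
  NT := ℕ
  initial := g.1
  rules := g.ruleSet

/-- The language generated by a code from its initial variable. -/
def language {α : Type} [DecidableEq α] (g : GrammarCode α) : Language α := g.toCFG.language

/-- Rename the terminals. -/
def mapTerminals {α β : Type} (f : α → β) (g : GrammarCode α) : GrammarCode β :=
  (g.1, g.2.map fun r => (r.1, r.2.map (Sum.map f id)))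

end GrammarCode

/-- Renaming variables maps derivations to derivations. -/
theorem mem_language_of_renaming {α : Type} {G G' : ContextFreeGrammar α}
    (F : Symbol α G.NT → Symbol α G'.NT) (f : G.NT → G'.NT)
    (hFt : ∀ a, F (.terminal a) = .terminal a)
    (hFn : ∀ X, F (.nonterminal X) = .nonterminal (f X))
    (hinit : f G.initial = G'.initial)
    (hrule : ∀ r ∈ G.rules, ⟨f r.input, r.output.map F⟩ ∈ G'.rules)
    {w : List α} (hw : w ∈ G.language) : w ∈ G'.language := by
  have key : ∀ u v, G.Derives u v → G'.Derives (u.map F) (v.map F) := by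
    intro u v huv
    refine Relation.ReflTransGen.lift (p := G'.Produces) (List.map F) ?_ u v huv
    rintro a b ⟨r, hr, hab⟩
    refine ⟨_, hrule r hr, ?_⟩
    obtain ⟨x, y, rfl, rfl⟩ := hab.exists_parts
    refine ContextFreeRule.rewrites_iff.2 ⟨x.map F, y.map F, ?_, ?_⟩
    · simp only [List.map_append, List.map_cons, List.map_nil, hFn]
    · simp only [List.map_append]
  have h := key _ _ hw
  have hFw : (w.map Symbol.terminal).map F = w.map Symbol.terminal := by
    rw [List.map_map]
    exact List.map_congr_left fun a _ => hFt a
  rw [hFw, List.map_cons, List.map_nil, hFn, hinit] at h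
  exact h

/-- Codes describe exactly the context-free languages. -/
theorem isContextFree_iff_exists_grammarCode {α : Type} [DecidableEq α] (L : Language α) :
    L.IsContextFree ↔ ∃ g : GrammarCode α, g.language = L := by
  constructor
  · rintro ⟨G, rfl⟩
    let S : Set G.NT := insert G.initial (⋃ r ∈ G.rules,
      insert r.input {X | Symbol.nonterminal X ∈ r.output})
    have hS : S.Finite := by
      refine Set.Finite.insert _ (Set.Finite.biUnion (Finset.finite_toSet _) fun r _ =>
        Set.Finite.insert _ ?_)
      exact Set.Finite.preimage (fun _ _ _ _ h => Symbol.nonterminal.inj h)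
        (List.finite_toSet r.output)
    obtain ⟨f, hf⟩ := Set.countable_iff_exists_injOn.mp hS.countable
    have : Nonempty G.NT := ⟨G.initial⟩
    let h : ℕ → G.NT := Function.invFunOn f S
    have hhf : ∀ X ∈ S, h (f X) = X := fun X hX => hf.leftInvOn_invFunOn hX
    let F : Symbol α G.NT → Symbol α ℕ := fun
      | .terminal a => .terminal a
      | .nonterminal X => .nonterminal (f X)
    let H : Symbol α ℕ → Symbol α G.NT := fun
      | .terminal a => .terminal a
      | .nonterminal X => .nonterminal (h X)
    let C : Symbol α G.NT → α ⊕ ℕ := fun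
      | .terminal a => .inl a
      | .nonterminal X => .inr (f X)
    have hfun : GrammarCode.toSymbol ∘ C = F := by
      funext s; rcases s with _ | _ <;> rfl
    let g : GrammarCode α := (f G.initial, G.rules.toList.map fun r => (f r.input, r.output.map C))
    have hmem : ∀ r' : ContextFreeRule α ℕ, r' ∈ g.ruleSet ↔
        ∃ r ∈ G.rules, r' = ⟨f r.input, r.output.map F⟩ := by
      intro r'
      simp only [GrammarCode.ruleSet, g, List.mem_toFinset, List.mem_map, List.map_map,
        Finset.mem_toList]
      constructor
      · rintro ⟨r, hr, rfl⟩
        exact ⟨r, hr, by simp [hfun]⟩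
      · rintro ⟨r, hr, rfl⟩
        exact ⟨r, hr, by simp [hfun]⟩
    refine ⟨g, ?_⟩
    ext w
    constructor
    · refine mem_language_of_renaming (G := g.toCFG) (G' := G) H h (fun _ => rfl) (fun _ => rfl)
        (hhf _ (Set.mem_insert _ _)) ?_
      intro r' hr'
      obtain ⟨r, hr, rfl⟩ := (hmem r').1 hr'
      have hi : h (f r.input) = r.input :=
        hhf _ (Set.mem_insert_of_mem _ (Set.mem_biUnion hr (Set.mem_insert _ _)))
      have ho : (r.output.map F).map H = r.output := by
        rw [List.map_map]
        conv_rhs => rw [← List.map_id r.output]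
        refine List.map_congr_left fun s hs => ?_
        rcases s with a | X
        · rfl
        · exact congrArg Symbol.nonterminal
            (hhf _ (Set.mem_insert_of_mem _ (Set.mem_biUnion hr (Set.mem_insert_of_mem _ hs))))
      have he : (⟨h (f r.input), (r.output.map F).map H⟩ : ContextFreeRule α G.NT) = r := by
        rw [hi, ho]
      exact he.symm ▸ hr
    · exact mem_language_of_renaming (G := G) (G' := g.toCFG) F f (fun _ => rfl) (fun _ => rfl)
        rfl (fun r hr => (hmem _).2 ⟨r, hr, rfl⟩)
  · rintro ⟨g, rfl⟩
    exact ⟨g.toCFG, rfl⟩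

/-! ### Elementary bounded languages, substitutions, Parikh images -/

/-- The elementary bounded language `w₁* w₂* ⋯ wₖ*` of the words `w₁, …, wₖ`. -/
def elementaryBounded {α : Type} (ws : List (List α)) : Language α :=
  (ws.map fun w => KStar.kstar ({w} : Language α)).prod

/-- A substitution from `α` to `β`: a map from words over `α` to languages over `β` that sends the
empty word to `{ε}` and concatenation of words to concatenation of languages. -/
abbrev LangSubstitution (α β : Type) : Type := FreeMonoid α →* Language β

namespace LangSubstitution

/-- The image `σ(a)` of a letter. -/
def onLetter {α β : Type} (σ : LangSubstitution α β) (a : α) : Language β := σ (FreeMonoid.of a)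

/-- The image `σ(L) = ⋃_{w ∈ L} σ(w)` of a language. -/
def onLanguage {α β : Type} (σ : LangSubstitution α β) (L : Language α) : Language β :=
  {v | ∃ w ∈ L, v ∈ σ (FreeMonoid.ofList w)}

end LangSubstitution

/-- The Parikh image of a word: the vector that counts the occurrences of each letter. -/
def parikhVector {α : Type} [DecidableEq α] (w : List α) : α → ℕ := fun a => w.count a

/-- The Parikh image of a language. -/
def parikhImage {α : Type} [DecidableEq α] (L : Language α) : Set (α → ℕ) :=
  {x | ∃ w ∈ L, parikhVector w = x}

/-! ### Inputs and outputs of procedures as finite data, letters being written as numbers -/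

/-- A finite list of words over the `n`-letter alphabet, as numerical data. -/
def wordsCode {n : ℕ} (ws : List (List (Fin n))) : List (List ℕ) := ws.map (List.map Fin.val)

/-- Numerical input data: the two alphabet sizes, a grammar, the words of an elementary bounded
language, and, letter by letter, the grammars and the lists of words that present two
substitutions. -/
abbrev SubstInput : Type :=
  ℕ × ℕ × GrammarCode ℕ × List (List ℕ) × List (GrammarCode ℕ) × List (List (List ℕ))

/-- The numerical data of a concrete instance over the alphabets `Fin p` and `Fin q`. -/
def substInput {p q : ℕ} (g : GrammarCode (Fin p)) (ws : List (List (Fin p)))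
    (gs : Fin p → GrammarCode (Fin q)) (ts : Fin p → List (List (Fin q))) : SubstInput :=
  (p, q, g.mapTerminals Fin.val, wordsCode ws,
    List.ofFn (fun a => (gs a).mapTerminals Fin.val), List.ofFn (fun a => wordsCode (ts a)))

/-!
Neither the grammar of `L` nor a construction of a grammar for `σ(L)` plays a role. Since all words
of length at most `N`, listed `r` times over, present an elementary bounded language containing
every product of `r` powers of such words, it suffices to bound computably, in terms of the data,
numbers `r` and `N` such that every word of `σ(L)` is Parikh equivalent to a word of `σ(L)` that is
a product of `r` powers of words of length at most `N` (`HasPowerProducts`).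

A word of `σ(L)` is Parikh equivalent to one in `σ(u)` with `u = w₁^{t₁} ⋯ wₖ^{tₖ}` in `L ∩ B`, hence
in `σ(w₁)^{t₁} ⋯ σ(wₖ)^{tₖ}`. So the point is to treat the powers `Z ^ t` of a language `Z = σ(w)`
uniformly in `t`. This is possible if the Parikh image of `Z` is a union of boundedly many classes,
each with a short constant `c` in the Parikh image of `Z`, such that the differences `x - c` within a
class are closed under addition (`HasParikhDecomposition`). In a sum of `t` elements, those of one
class can then be replaced by copies of `c` and a single further element of the class; the copies of
`c` are realized by a power of one short word, and the single element by a word in `σ(w)` that comes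
from the languages `σ(a) ∩ τ(a)` (`HasParikhDecomposition.hasPowerProducts_pow`).

Both properties are stable under products, so decompositions are needed only for the languages
`σ(a)`, which are context-free: this is a form of Parikh's theorem with an explicit bound
(`ContextFreeGrammar.hasParikhDecomposition`). Label each inner node of a derivation tree by its
variable and the set of variables in its subtree. If a label occurs twice on a path, the part
between the two occurrences can be cut out without changing the set `S` of variables of the whole
tree, and it is a pump that can be inserted into any tree with the set `S`. Once no label is repeated
on a path, the height, and with it the yield, is bounded
(`ContextFreeGrammar.ParikhDerives.exists_reduced`). A class consists of the Parikh vectors `c + z`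
for a fixed short `c` derivable with variable set `S`, where `z` is any sum of pumps of `S`.
-/

/-! ### Parikh vectors -/

section ParikhVector

variable {α : Type} [DecidableEq α]

@[simp] theorem parikhVector_nil : parikhVector ([] : List α) = 0 := rfl

@[simp] theorem parikhVector_append (u v : List α) :
    parikhVector (u ++ v) = parikhVector u + parikhVector v := by
  ext a
  simp [parikhVector]

theorem parikhVector_cons (a : α) (w : List α) :
    parikhVector (a :: w) = Pi.single a 1 + parikhVector w := by
  ext b
  by_cases h : b = a
  · subst h
    simp [parikhVector, add_comm]
  · simp [parikhVector, h, Ne.symm h]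

theorem perm_of_parikhVector_eq {u v : List α} (h : parikhVector u = parikhVector v) :
    u.Perm v :=
  List.perm_iff_count.2 fun a => congrFun h a

theorem sum_parikhVector [Fintype α] (w : List α) : ∑ a, parikhVector w a = w.length := by
  induction w with
  | nil => simp
  | cons a w ih => simp [parikhVector_cons, Finset.sum_add_distrib, ih, add_comm]

theorem mem_parikhImage_mul {Y Z : Language α} {x : α → ℕ} :
    x ∈ parikhImage (Y * Z) ↔ ∃ y ∈ parikhImage Y, ∃ z ∈ parikhImage Z, y + z = x := by
  constructor
  · rintro ⟨_, ⟨u, hu, v, hv, rfl⟩, rfl⟩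
    exact ⟨_, ⟨u, hu, rfl⟩, _, ⟨v, hv, rfl⟩, (parikhVector_append u v).symm⟩
  · rintro ⟨_, ⟨u, hu, rfl⟩, _, ⟨v, hv, rfl⟩, rfl⟩
    exact ⟨u ++ v, ⟨u, hu, v, hv, rfl⟩, parikhVector_append u v⟩

theorem parikhImage_congr_mul {X Y Z : Language α} (h : parikhImage Y = parikhImage Z) :
    parikhImage (X * Y) = parikhImage (X * Z) := by
  ext x
  simp only [mem_parikhImage_mul, h]

end ParikhVector

/-! ### Commutative derivations and pumping -/

namespace ContextFreeGrammar

variable {α : Type} [DecidableEq α]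

/-- `G.ParikhDerives P W x S`: the sentential form `W` has a derivation forest whose yield has
Parikh vector `x`, in which exactly the variables in `S` occur. Moreover, at each inner node of the
forest, the pair of its variable and the set of variables occurring in its subtree lies in `P`. -/
inductive ParikhDerives (G : ContextFreeGrammar α) [DecidableEq G.NT]
    (P : Set (G.NT × Finset G.NT)) :
    List (Symbol α G.NT) → (α → ℕ) → Finset G.NT → Prop
  | nil : ParikhDerives G P [] 0 ∅
  | terminal (a : α) {W x S} (h : ParikhDerives G P W x S) :
      ParikhDerives G P (.terminal a :: W) (Pi.single a 1 + x) S
  | node (r : ContextFreeRule α G.NT) (hr : r ∈ G.rules) {x S W y T}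
      (hx : ParikhDerives G P r.output x S) (hy : ParikhDerives G P W y T)
      (hP : (r.input, insert r.input S) ∈ P) :
      ParikhDerives G P (.nonterminal r.input :: W) (x + y) (insert r.input S ∪ T)

variable {G : ContextFreeGrammar α} [DecidableEq G.NT] {P Q : Set (G.NT × Finset G.NT)}

namespace ParikhDerives

theorem mono (hPQ : P ⊆ Q) {W x S} (h : G.ParikhDerives P W x S) : G.ParikhDerives Q W x S := by
  induction h with
  | nil => exact .nil
  | terminal a _ ih => exact .terminal a ih
  | node r hr _ _ hP ihx ihy => exact .node r hr ihx ihy (hPQ hP)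

theorem append {U V x y S T} (hU : G.ParikhDerives P U x S) (hV : G.ParikhDerives P V y T) :
    G.ParikhDerives P (U ++ V) (x + y) (S ∪ T) := by
  induction hU with
  | nil => simpa using hV
  | terminal a _ ih => simpa [add_assoc] using ParikhDerives.terminal a ih
  | node r hr hx _ hP _ ih =>
    have := ParikhDerives.node r hr hx ih hP
    rwa [← add_assoc, ← Finset.union_assoc] at this

theorem exists_of_append {U V : List (Symbol α G.NT)} {x S}
    (h : G.ParikhDerives P (U ++ V) x S) :
    ∃ y T z R, G.ParikhDerives P U y T ∧ G.ParikhDerives P V z R ∧ x = y + z ∧ S = T ∪ R := by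
  induction U generalizing x S with
  | nil => exact ⟨0, ∅, x, S, .nil, h, by simp, by simp⟩
  | cons s U ih =>
    cases h with
    | terminal a h =>
      obtain ⟨y, T, z, R, hy, hz, rfl, rfl⟩ := ih h
      exact ⟨_, _, _, _, .terminal a hy, hz, (add_assoc _ _ _).symm, rfl⟩
    | node r hr hx h hP =>
      obtain ⟨y, T, z, R, hy, hz, rfl, rfl⟩ := ih h
      exact ⟨_, _, _, _, .node r hr hx hy hP, hz, (add_assoc _ _ _).symm,
        (Finset.union_assoc _ _ _).symm⟩

theorem of_word (w : List α) :
    G.ParikhDerives P (w.map .terminal) (parikhVector w) ∅ := by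
  induction w with
  | nil => exact .nil
  | cons a w ih =>
    rw [parikhVector_cons]
    exact .terminal a ih

theorem exists_derives {W x S} (h : G.ParikhDerives P W x S) :
    ∃ w : List α, parikhVector w = x ∧ G.Derives W (w.map .terminal) := by
  induction h with
  | nil => exact ⟨[], rfl, .refl _⟩
  | terminal a _ ih =>
    obtain ⟨w, rfl, hw⟩ := ih
    exact ⟨a :: w, parikhVector_cons a w, hw.append_left [.terminal a]⟩
  | @node r hr x S W y T _ _ _ ihx ihy =>
    obtain ⟨u, rfl, hu⟩ := ihx
    obtain ⟨v, rfl, hv⟩ := ihy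
    refine ⟨u ++ v, parikhVector_append u v, ?_⟩
    have h1 : G.Produces ([.nonterminal r.input] ++ W) (r.output ++ W) :=
      ⟨r, hr, (ContextFreeRule.Rewrites.input_output).append_right W⟩
    rw [List.map_append]
    exact h1.trans_derives ((hu.append_right W).trans (hv.append_left _))

theorem exists_of_derives {W : List (Symbol α G.NT)} {w : List α}
    (h : G.Derives W (w.map .terminal)) :
    ∃ S, G.ParikhDerives Set.univ W (parikhVector w) S := by
  induction h using Relation.ReflTransGen.head_induction_on with
  | refl => exact ⟨∅, of_word w⟩
  | head hprod _ ih =>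
    obtain ⟨S, hS⟩ := ih
    obtain ⟨r, hr, hrew⟩ := hprod
    obtain ⟨p, q, rfl, rfl⟩ := hrew.exists_parts
    obtain ⟨y, T, z, R, hy, hz, hx, -⟩ := exists_of_append hS
    obtain ⟨y₁, T₁, y₂, T₂, h₁, h₂, rfl, -⟩ := exists_of_append hy
    have := h₁.append (ParikhDerives.node r hr h₂ hz (Set.mem_univ _))
    rw [← add_assoc, ← hx] at this
    refine ⟨_, by simpa using this⟩

theorem subset_inputs {W x S} (h : G.ParikhDerives P W x S) :
    S ⊆ G.rules.image ContextFreeRule.input := by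
  induction h with
  | nil => simp
  | terminal _ _ ih => exact ih
  | node r hr _ _ _ ihx ihy =>
    exact Finset.union_subset
      (Finset.insert_subset (Finset.mem_image_of_mem _ hr) ihx) ihy

/-- Only finitely many pairs of a variable and a set of variables can occur in a derivation. -/
theorem restrict {W x S} (h : G.ParikhDerives P W x S) :
    G.ParikhDerives ((G.rules.image ContextFreeRule.input ×ˢ
      (G.rules.image ContextFreeRule.input).powerset : Finset _) : Set _) W x S := by
  induction h with
  | nil => exact .nil
  | terminal a _ ih => exact .terminal a ih
  | node r hr hx _ _ ihx ihy =>
    have hri := Finset.mem_image_of_mem ContextFreeRule.input hr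
    refine .node r hr ihx ihy ?_
    rw [Finset.mem_coe, Finset.mem_product, Finset.mem_powerset]
    exact ⟨hri, Finset.insert_subset hri hx.subset_inputs⟩

end ParikhDerives

/-- A derivation context from the sentential form `W` to the variable `A`: it turns derivations
from `A` into derivations from `W`, thereby adding `z` to the Parikh vector and `R` to the set of
variables. -/
def IsParikhContext (G : ContextFreeGrammar α) [DecidableEq G.NT] (W : List (Symbol α G.NT))
    (A : G.NT) (z : α → ℕ) (R : Finset G.NT) : Prop :=
  ∀ x S, G.ParikhDerives Set.univ [.nonterminal A] x S →
    G.ParikhDerives Set.univ W (z + x) (R ∪ S)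

/-- The sums of Parikh vectors of pumps `A ⇒* u A v`, where `A ∈ S` and only variables in `S` are
used. -/
def pumps (G : ContextFreeGrammar α) [DecidableEq G.NT] (S : Finset G.NT) :
    AddSubmonoid (α → ℕ) :=
  AddSubmonoid.closure {z | ∃ A ∈ S, ∃ R ⊆ S, G.IsParikhContext [.nonterminal A] A z R}

theorem pumps_mono {S T : Finset G.NT} (h : S ⊆ T) : G.pumps S ≤ G.pumps T :=
  AddSubmonoid.closure_mono fun _ ⟨A, hA, R, hR, hz⟩ => ⟨A, h hA, R, hR.trans h, hz⟩

namespace ParikhDerives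

/-- A pump at a variable occurring in a derivation can be inserted there. -/
theorem insert_pump {A : G.NT} {z R} (hz : G.IsParikhContext [.nonterminal A] A z R) {W x S}
    (h : G.ParikhDerives P W x S) (hA : A ∈ S) :
    G.ParikhDerives Set.univ W (x + z) (S ∪ R) := by
  induction h with
  | nil => simp at hA
  | terminal a _ ih => simpa [add_assoc] using ParikhDerives.terminal a (ih hA)
  | @node r hr x S W y T hx hy hP ihx ihy =>
    have hx' := hx.mono (Set.subset_univ _)
    have hy' := hy.mono (Set.subset_univ _)
    rw [Finset.mem_union, Finset.mem_insert] at hA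
    rcases hA with (rfl | hA) | hA
    · have h1 := (hz _ _ (.node r hr hx' .nil (Set.mem_univ _))).append hy'
      rw [List.singleton_append] at h1
      convert h1 using 1
      · abel
      · ext B; simp; tauto
    · have h1 := ParikhDerives.node r hr (ihx hA) hy' (Set.mem_univ _)
      convert h1 using 1
      · abel
      · ext B; simp; tauto
    · have h1 := ParikhDerives.node r hr hx' (ihy hA) (Set.mem_univ _)
      rwa [← add_assoc, ← Finset.union_assoc] at h1

theorem add_pumps {W x S} (h : G.ParikhDerives Set.univ W x S) {z : α → ℕ} (hz : z ∈ G.pumps S) :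
    G.ParikhDerives Set.univ W (x + z) S := by
  induction hz using AddSubmonoid.closure_induction generalizing x with
  | mem z hz =>
    obtain ⟨A, hA, R, hR, hz⟩ := hz
    simpa [Finset.union_eq_left.2 hR] using h.insert_pump hz hA
  | zero => simpa using h
  | add y z _ _ ihy ihz => simpa [add_assoc] using ihz (ihy h)

/-- Either the pair `(A, V)` does not occur in a derivation, or there is an innermost occurrence:
below it, the pair does not occur again. -/
theorem avoid_or_exists_innermost (A : G.NT) (V : Finset G.NT) {W x S}
    (h : G.ParikhDerives P W x S) :
    G.ParikhDerives (P \ {(A, V)}) W x S ∨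
      ∃ r ∈ G.rules, r.input = A ∧ ∃ x' V' z R,
        G.ParikhDerives (P \ {(A, V)}) r.output x' V' ∧ insert A V' = V ∧
        G.IsParikhContext W A z R ∧ R ⊆ S ∧ x = z + x' := by
  induction h with
  | nil => exact .inl .nil
  | terminal a _ ih =>
    rcases ih with ih | ⟨r, hr, hrA, x', V', z, R, hx', hV', hz, hR, rfl⟩
    · exact .inl (.terminal a ih)
    · refine .inr ⟨r, hr, hrA, x', V', Pi.single a 1 + z, R, hx', hV', fun y T hy => ?_, hR,
        (add_assoc _ _ _).symm⟩
      rw [add_assoc]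
      exact .terminal a (hz y T hy)
  | @node r hr x S W y T hx hy hP ihx ihy =>
    have hxu := hx.mono (Set.subset_univ _)
    have hy' := hy.mono (Set.subset_univ _)
    rcases ihx with ihx | ⟨q, hq, hqA, x', V', z, R, hx', hV', hz, hR, rfl⟩
    · rcases ihy with ihy | ⟨q, hq, hqA, x', V', z, R, hx'', hV', hz, hR, rfl⟩
      · by_cases hAV : (r.input, insert r.input S) = (A, V)
        · obtain ⟨rfl, rfl⟩ := Prod.mk.inj hAV
          refine .inr ⟨r, hr, rfl, x, S, y, T, ihx, rfl, fun u U hu => ?_,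
            Finset.subset_union_right, add_comm _ _⟩
          simpa [add_comm, Finset.union_comm] using hu.append hy'
        · exact .inl (.node r hr ihx ihy ⟨hP, hAV⟩)
      · refine .inr ⟨q, hq, hqA, x', V', x + z, insert r.input S ∪ R, hx'', hV',
          fun u U hu => ?_, Finset.union_subset_union_right hR, (add_assoc _ _ _).symm⟩
        rw [add_assoc, Finset.union_assoc]
        exact .node r hr hxu (hz u U hu) (Set.mem_univ _)
    · refine .inr ⟨q, hq, hqA, x', V', z + y, insert r.input R ∪ T, hx', hV',
        fun u U hu => ?_, Finset.union_subset_union_left (Finset.insert_subset_insert _ hR),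
        add_right_comm _ _ _⟩
      have h1 := ParikhDerives.node r hr (hz u U hu) hy' (Set.mem_univ _)
      convert h1 using 1
      · abel
      · ext B; simp; tauto

/-- Cutting out pumps, every derivation reduces to one with the same set of variables whose yield
is bounded in length: once the innermost of the nodes that carry a given pair has been moved up to
the topmost one, the pair does not occur further below. -/
theorem exists_reduced [Fintype α] {d : ℕ} (hd : ∀ r ∈ G.rules, r.output.length ≤ d)
    (hd₁ : 1 ≤ d) (P : Finset (G.NT × Finset G.NT)) {W x S} (h : G.ParikhDerives P W x S) :
    ∃ c z, G.ParikhDerives Set.univ W c S ∧ z ∈ G.pumps S ∧ x = c + z ∧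
      ∑ a, c a ≤ W.length * d ^ P.card := by
  induction P using Finset.strongInduction generalizing W x S with
  | H P IH =>
    generalize hP' : (P : Set (G.NT × Finset G.NT)) = P' at h
    induction h with
    | nil => exact ⟨0, 0, .nil, zero_mem _, by simp, by simp⟩
    | terminal a _ ih =>
      obtain ⟨c, z, hc, hz, rfl, hle⟩ := ih
      refine ⟨_, z, .terminal a hc, hz, (add_assoc _ _ _).symm, ?_⟩
      have := Nat.one_le_pow P.card d hd₁
      simp only [Pi.add_apply, Finset.sum_add_distrib, Finset.sum_pi_single', Finset.mem_univ,
        if_true, List.length_cons, add_mul, one_mul]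
      omega
    | @node r hr x S W y T hx hy hP _ ihy =>
      obtain ⟨c₂, z₂, hc₂, hz₂, rfl, hle₂⟩ := ihy
      subst hP'
      have hPmem : (r.input, insert r.input S) ∈ P := hP
      -- A production for the same variable at the root, below which the label of the root does not
      -- occur any more.
      obtain ⟨q, hq, hqr, c₁, z₁, V', hc₁, hV', hz₁, rfl, hle₁⟩ :
          ∃ q ∈ G.rules, q.input = r.input ∧ ∃ c₁ z₁ V',
            G.ParikhDerives Set.univ q.output c₁ V' ∧
            insert r.input V' = insert r.input S ∧ z₁ ∈ G.pumps (insert r.input S) ∧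
            x = c₁ + z₁ ∧ ∑ a, c₁ a ≤ d ^ P.card := by
        have key : ∀ q ∈ G.rules, ∀ x' V',
            G.ParikhDerives (P \ {(r.input, insert r.input S)}) q.output x' V' →
            ∃ c z, G.ParikhDerives Set.univ q.output c V' ∧ z ∈ G.pumps V' ∧ x' = c + z ∧
              ∑ a, c a ≤ d ^ P.card := by
          intro q hq x' V' h'
          rw [← Finset.coe_erase] at h'
          obtain ⟨c, z, hc, hz, rfl, hle⟩ := IH _ (Finset.erase_ssubset hPmem) h'
          refine ⟨c, z, hc, hz, rfl, hle.trans ?_⟩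
          rw [← Finset.card_erase_add_one hPmem, pow_succ']
          exact Nat.mul_le_mul_right _ (hd q hq)
        rcases hx.avoid_or_exists_innermost r.input (insert r.input S) with
          h' | ⟨q, hq, hqr, x', V', z, R, h', hV', hctx, hR, rfl⟩
        -- The label of the root does not recur below the root.
        · obtain ⟨c, z, hc, hz, rfl, hle⟩ := key r hr _ _ h'
          exact ⟨r, hr, rfl, c, z, S, hc, rfl, pumps_mono (Finset.subset_insert _ _) hz, rfl, hle⟩
        -- Otherwise the innermost node with this label replaces the root; the context `z` cut out
        -- is a pump.
        · obtain ⟨c, z', hc, hz', rfl, hle⟩ := key q hq _ _ h'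
          refine ⟨q, hq, hqr, c, z + z', V', hc, hV', add_mem ?_ ?_, by abel, hle⟩
          · refine AddSubmonoid.subset_closure ⟨r.input, Finset.mem_insert_self _ _,
              insert r.input R, Finset.insert_subset_insert _ hR, fun u U hu => ?_⟩
            simpa using ParikhDerives.node r hr (hctx u U hu) .nil (Set.mem_univ _)
          · refine pumps_mono ?_ hz'
            rw [← hV']
            exact Finset.subset_insert _ _
      refine ⟨c₁ + c₂, z₁ + z₂, ?_, add_mem (pumps_mono Finset.subset_union_left hz₁)
        (pumps_mono Finset.subset_union_right hz₂), by abel, ?_⟩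
      · have h1 := ParikhDerives.node q hq hc₁ hc₂ (Set.mem_univ _)
        rwa [hqr, hV'] at h1
      · simp only [Pi.add_apply, Finset.sum_add_distrib, List.length_cons, add_mul, one_mul]
        omega

end ParikhDerives

end ContextFreeGrammar

/-! ### Decompositions of Parikh images -/

section Decomposition

variable {α : Type} [DecidableEq α] [Fintype α]

/-- The Parikh image of `Z` is a union of at most `K` classes, each with a constant `c` in the
Parikh image of `Z`, of length at most `N`, such that the differences `x - c` of the elements `x` of
the class are closed under addition. This is the part of the semilinearity of the Parikh image that
is needed to sum up many elements. -/
def HasParikhDecomposition (Z : Language α) (K N : ℕ) : Prop :=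
  ∃ (ι : Type) (_ : Fintype ι) (cls : ι → Set (α → ℕ)) (c : ι → α → ℕ),
    Fintype.card ι ≤ K ∧ (∀ x ∈ parikhImage Z, ∃ i, x ∈ cls i) ∧
    (∀ i, cls i ⊆ parikhImage Z) ∧
    (∀ i, (cls i).Nonempty → c i ∈ parikhImage Z ∧ ∑ a, c i a ≤ N) ∧
    ∀ i, ∀ x ∈ cls i, ∀ y ∈ cls i, ∃ z ∈ cls i, x + y = c i + z

theorem HasParikhDecomposition.mono {Z : Language α} {K K' N N' : ℕ}
    (h : HasParikhDecomposition Z K N) (hK : K ≤ K') (hN : N ≤ N') :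
    HasParikhDecomposition Z K' N' := by
  obtain ⟨ι, hι, cls, c, hcard, hcov, hsub, hc, hadd⟩ := h
  exact ⟨ι, hι, cls, c, hcard.trans hK, hcov, hsub,
    fun i hi => ⟨(hc i hi).1, (hc i hi).2.trans hN⟩, hadd⟩

theorem HasParikhDecomposition.one : HasParikhDecomposition (1 : Language α) 1 0 := by
  have h0 : (0 : α → ℕ) ∈ parikhImage (1 : Language α) := ⟨[], Language.nil_mem_one, rfl⟩
  refine ⟨Unit, inferInstance, fun _ => {0}, fun _ => 0, by simp, ?_, ?_, ?_, ?_⟩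
  · rintro _ ⟨w, hw, rfl⟩
    rw [Language.mem_one] at hw
    subst hw
    exact ⟨(), rfl⟩
  · rintro _ _ rfl
    exact h0
  · exact fun _ _ => ⟨h0, by simp⟩
  · rintro _ _ rfl _ rfl
    exact ⟨0, rfl, rfl⟩

theorem HasParikhDecomposition.mul {Y Z : Language α} {K₁ K₂ N₁ N₂ : ℕ}
    (hY : HasParikhDecomposition Y K₁ N₁) (hZ : HasParikhDecomposition Z K₂ N₂) :
    HasParikhDecomposition (Y * Z) (K₁ * K₂) (N₁ + N₂) := by
  obtain ⟨ι, _, A, c, hcard, hcov, hsub, hc, hadd⟩ := hY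
  obtain ⟨κ, _, B, d, hcard', hcov', hsub', hd, hadd'⟩ := hZ
  refine ⟨ι × κ, inferInstance, fun i => {x | ∃ y ∈ A i.1, ∃ z ∈ B i.2, y + z = x},
    fun i => c i.1 + d i.2, ?_, ?_, ?_, ?_, ?_⟩
  · rw [Fintype.card_prod]
    exact Nat.mul_le_mul hcard hcard'
  · intro x hx
    obtain ⟨y, hy, z, hz, rfl⟩ := mem_parikhImage_mul.1 hx
    obtain ⟨i, hi⟩ := hcov y hy
    obtain ⟨j, hj⟩ := hcov' z hz
    exact ⟨(i, j), y, hi, z, hj, rfl⟩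
  · rintro ⟨i, j⟩ _ ⟨y, hy, z, hz, rfl⟩
    exact mem_parikhImage_mul.2 ⟨y, hsub i hy, z, hsub' j hz, rfl⟩
  · rintro ⟨i, j⟩ ⟨_, y, hy, z, hz, rfl⟩
    have h1 := hc i ⟨y, hy⟩
    have h2 := hd j ⟨z, hz⟩
    refine ⟨mem_parikhImage_mul.2 ⟨_, h1.1, _, h2.1, rfl⟩, ?_⟩
    simp only [Pi.add_apply, Finset.sum_add_distrib]
    exact Nat.add_le_add h1.2 h2.2
  · rintro ⟨i, j⟩ _ ⟨y, hy, z, hz, rfl⟩ _ ⟨y', hy', z', hz', rfl⟩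
    obtain ⟨u, hu, hyu⟩ := hadd i y hy y' hy'
    obtain ⟨v, hv, hzv⟩ := hadd' j z hz z' hz'
    refine ⟨u + v, ⟨u, hu, v, hv, rfl⟩, ?_⟩
    calc y + z + (y' + z') = (y + y') + (z + z') := by abel
      _ = c i + d j + (u + v) := by rw [hyu, hzv]; abel

/-- The classes of a context-free language: `c + z`, where `c` is the Parikh vector of a short word
that is derived with the set `S` of variables, and `z` is a sum of pumps of `S`. -/
theorem ContextFreeGrammar.hasParikhDecomposition (G : ContextFreeGrammar α) {d m N : ℕ}
    (hd : ∀ r ∈ G.rules, r.output.length ≤ d) (hd₁ : 1 ≤ d) (hm : G.rules.card ≤ m)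
    (hN : d ^ (m * 2 ^ m) ≤ N) :
    HasParikhDecomposition G.language ((N + 1) ^ Fintype.card α * 2 ^ m) N := by
  classical
  set V := G.rules.image ContextFreeRule.input with hV
  have hVm : V.card ≤ m := Finset.card_image_le.trans hm
  let con : (α → Fin (N + 1)) × V.powerset → α → ℕ := fun i a => i.1 a
  have hlang : ∀ {x S}, G.ParikhDerives Set.univ [.nonterminal G.initial] x S →
      x ∈ parikhImage G.language := by
    intro x S h
    obtain ⟨w, hw, hder⟩ := h.exists_derives
    exact ⟨w, hder, hw⟩
  refine ⟨(α → Fin (N + 1)) × V.powerset, inferInstance,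
    fun i => {x | G.ParikhDerives Set.univ [.nonterminal G.initial] (con i) i.2 ∧
      ∑ a, con i a ≤ N ∧ ∃ z ∈ G.pumps i.2, x = con i + z}, con, ?_, ?_, ?_, ?_, ?_⟩
  · rw [Fintype.card_prod, Fintype.card_fun, Fintype.card_fin, Fintype.card_coe,
      Finset.card_powerset]
    exact Nat.mul_le_mul_left _ (Nat.pow_le_pow_right two_pos hVm)
  · rintro _ ⟨w, hw, rfl⟩
    obtain ⟨S, hS⟩ := ParikhDerives.exists_of_derives hw
    obtain ⟨c, z, hc, hz, hx, hle⟩ := hS.restrict.exists_reduced hd hd₁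
    have hcN : ∑ a, c a ≤ N := by
      refine hle.trans (le_trans ?_ hN)
      rw [List.length_singleton, one_mul, Finset.card_product, Finset.card_powerset]
      exact Nat.pow_le_pow_right hd₁ (Nat.mul_le_mul hVm (Nat.pow_le_pow_right two_pos hVm))
    have hca : ∀ a, c a < N + 1 := fun a => Nat.lt_succ_of_le
      ((Finset.single_le_sum (fun _ _ => Nat.zero_le _) (Finset.mem_univ a)).trans hcN)
    exact ⟨(fun a => ⟨c a, hca a⟩, ⟨S, Finset.mem_powerset.2 hS.subset_inputs⟩), hc, hcN, z, hz, hx⟩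
  · rintro i _ ⟨h, -, z, hz, rfl⟩
    exact hlang (h.add_pumps hz)
  · rintro i ⟨x, h, hle, -⟩
    exact ⟨hlang h, hle⟩
  · rintro i _ ⟨h, hle, y, hy, rfl⟩ _ ⟨-, -, z, hz, rfl⟩
    exact ⟨con i + (y + z), ⟨h, hle, y + z, add_mem hy hz, rfl⟩, by abel⟩

end Decomposition

/-! ### Products of powers of short words -/

section PowerProduct

variable {α : Type}

/-- `w` is a product of at most `r` powers of words of length at most `N`. -/
def IsPowerProduct (r N : ℕ) (w : List α) : Prop :=
  ∃ l : List (List α × ℕ), l.length ≤ r ∧ (∀ b ∈ l, b.1.length ≤ N) ∧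
    w = (l.map fun b => (List.replicate b.2 b.1).flatten).flatten

theorem IsPowerProduct.nil (r N : ℕ) : IsPowerProduct r N ([] : List α) :=
  ⟨[], by simp, by simp, rfl⟩

theorem IsPowerProduct.mono {r r' N N' : ℕ} {w : List α} (h : IsPowerProduct r N w)
    (hr : r ≤ r') (hN : N ≤ N') : IsPowerProduct r' N' w := by
  obtain ⟨l, hl, hb, rfl⟩ := h
  exact ⟨l, hl.trans hr, fun b h => (hb b h).trans hN, rfl⟩

theorem IsPowerProduct.append {r s N : ℕ} {u v : List α} (hu : IsPowerProduct r N u)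
    (hv : IsPowerProduct s N v) : IsPowerProduct (r + s) N (u ++ v) := by
  obtain ⟨l, hl, hb, rfl⟩ := hu
  obtain ⟨l', hl', hb', rfl⟩ := hv
  refine ⟨l ++ l', by simp; omega, ?_, by simp⟩
  intro b h
  rcases List.mem_append.1 h with h | h
  exacts [hb b h, hb' b h]

theorem isPowerProduct_replicate {N : ℕ} {w : List α} (hw : w.length ≤ N) (n : ℕ) :
    IsPowerProduct 1 N (List.replicate n w).flatten :=
  ⟨[(w, n)], by simp, by simpa using hw, by simp⟩

theorem elementaryBounded_append (us vs : List (List α)) :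
    elementaryBounded (us ++ vs) = elementaryBounded us * elementaryBounded vs := by
  simp [elementaryBounded]

theorem elementaryBounded_cons (w : List α) (ws : List (List α)) :
    elementaryBounded (w :: ws) = KStar.kstar ({w} : Language α) * elementaryBounded ws := by
  simp [elementaryBounded]

theorem mem_kstar_singleton {w v : List α} :
    v ∈ KStar.kstar ({w} : Language α) ↔ ∃ n, v = (List.replicate n w).flatten := by
  rw [Language.mem_kstar]
  constructor
  · rintro ⟨l, rfl, hl⟩
    exact ⟨l.length, by rw [← List.eq_replicate_of_mem (a := w) fun y hy => hl y hy]⟩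
  · rintro ⟨n, rfl⟩
    exact ⟨_, rfl, fun y hy => List.eq_of_mem_replicate hy⟩

theorem nil_mem_elementaryBounded (ws : List (List α)) : [] ∈ elementaryBounded ws := by
  induction ws with
  | nil => exact Language.nil_mem_one
  | cons w ws ih =>
    rw [elementaryBounded_cons]
    exact ⟨[], Language.nil_mem_kstar _, [], ih, rfl⟩

theorem replicate_flatten_mem_elementaryBounded {ws : List (List α)} {w : List α} (hw : w ∈ ws)
    (n : ℕ) : (List.replicate n w).flatten ∈ elementaryBounded ws := by
  obtain ⟨us, vs, rfl⟩ := List.append_of_mem hw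
  rw [elementaryBounded_append, elementaryBounded_cons]
  exact ⟨[], nil_mem_elementaryBounded _, _,
    ⟨_, mem_kstar_singleton.2 ⟨n, rfl⟩, [], nil_mem_elementaryBounded _, rfl⟩, by simp⟩

theorem isPowerProduct_of_mem_elementaryBounded {N : ℕ} {ws : List (List α)}
    (hws : ∀ w ∈ ws, w.length ≤ N) {v : List α} (hv : v ∈ elementaryBounded ws) :
    IsPowerProduct ws.length N v := by
  induction ws generalizing v with
  | nil =>
    obtain rfl : v = [] := hv
    exact .nil _ _
  | cons w ws ih =>
    rw [elementaryBounded_cons] at hv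
    obtain ⟨x, hx, y, hy, rfl⟩ := hv
    obtain ⟨n, rfl⟩ := mem_kstar_singleton.1 hx
    rw [List.length_cons, add_comm]
    exact (isPowerProduct_replicate (hws w (by simp)) n).append
      (ih (fun u hu => hws u (by simp [hu])) hy)

/-- The words of length at most `N`, listed `r` times over, present an elementary bounded language
that contains all products of `r` powers of such words. -/
theorem IsPowerProduct.mem_elementaryBounded {r N : ℕ} {v : List α} (hv : IsPowerProduct r N v)
    {ws : List (List α)} (hws : ∀ w : List α, w.length ≤ N → w ∈ ws) :
    v ∈ elementaryBounded (List.replicate r ws).flatten := by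
  obtain ⟨l, hl, hb, rfl⟩ := hv
  induction l generalizing r with
  | nil => exact nil_mem_elementaryBounded _
  | cons b l ih =>
    obtain ⟨r, rfl⟩ : ∃ k, r = k + 1 := ⟨r - 1, by simp at hl; omega⟩
    rw [List.replicate_succ, List.flatten_cons, elementaryBounded_append]
    exact ⟨_, replicate_flatten_mem_elementaryBounded (hws b.1 (hb b (by simp))) b.2, _,
      ih (by simpa using hl) (fun c hc => hb c (by simp [hc])), by simp⟩

/-- The elements of the `t`-fold sumset of a class with constant `c`, written with a single element
of the class that absorbs all the differences. -/
def collected (cls : Set (α → ℕ)) (c : α → ℕ) : ℕ → Set (α → ℕ)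
  | 0 => {0}
  | t + 1 => {x | ∃ y ∈ cls, x = t • c + y}

theorem add_mem_collected {cls : Set (α → ℕ)} {c : α → ℕ}
    (hadd : ∀ x ∈ cls, ∀ y ∈ cls, ∃ z ∈ cls, x + y = c + z) {t : ℕ} {x y : α → ℕ}
    (hx : x ∈ collected cls c t) (hy : y ∈ cls) : x + y ∈ collected cls c (t + 1) := by
  cases t with
  | zero =>
    obtain rfl : x = 0 := hx
    exact ⟨y, hy, by simp⟩
  | succ t =>
    obtain ⟨u, hu, rfl⟩ := hx
    obtain ⟨z, hz, huz⟩ := hadd u hu y hy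
    exact ⟨z, hz, by rw [add_assoc, huz, succ_nsmul, add_assoc]⟩

theorem replicate_flatten_mem_pow {Z : Language α} {w : List α} (hw : w ∈ Z) (n : ℕ) :
    (List.replicate n w).flatten ∈ Z ^ n := by
  induction n with
  | zero => exact Language.nil_mem_one
  | succ n ih =>
    rw [pow_succ']
    exact ⟨w, hw, _, ih, by simp [List.replicate_succ]⟩

variable [DecidableEq α]

/-- Up to Parikh equivalence, all words of `Z` are products of `r` powers of words of length at most
`N`. -/
def HasPowerProducts (Z : Language α) (r N : ℕ) : Prop :=
  ∀ x ∈ parikhImage Z, ∃ v ∈ Z, parikhVector v = x ∧ IsPowerProduct r N v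

theorem HasPowerProducts.mono {Z : Language α} {r r' N N' : ℕ} (h : HasPowerProducts Z r N)
    (hr : r ≤ r') (hN : N ≤ N') : HasPowerProducts Z r' N' := by
  intro x hx
  obtain ⟨v, hv, hvx, hp⟩ := h x hx
  exact ⟨v, hv, hvx, hp.mono hr hN⟩

theorem HasPowerProducts.one (r N : ℕ) : HasPowerProducts (1 : Language α) r N := by
  rintro _ ⟨w, hw, rfl⟩
  obtain rfl := Language.mem_one _ |>.1 hw
  exact ⟨[], hw, rfl, .nil _ _⟩

theorem HasPowerProducts.mul {Y Z : Language α} {r s N : ℕ} (hY : HasPowerProducts Y r N)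
    (hZ : HasPowerProducts Z s N) : HasPowerProducts (Y * Z) (r + s) N := by
  intro x hx
  obtain ⟨y, hy, z, hz, rfl⟩ := mem_parikhImage_mul.1 hx
  obtain ⟨u, hu, rfl, hpu⟩ := hY y hy
  obtain ⟨v, hv, rfl, hpv⟩ := hZ z hz
  exact ⟨u ++ v, ⟨u, hu, v, hv, rfl⟩, parikhVector_append u v, hpu.append hpv⟩

theorem hasPowerProducts_of_elementaryBounded {Z : Language α} {ws : List (List α)} {N : ℕ}
    (hws : ∀ w ∈ ws, w.length ≤ N)
    (h : parikhImage (Z ⊓ elementaryBounded ws) = parikhImage Z) :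
    HasPowerProducts Z ws.length N := by
  intro x hx
  rw [← h] at hx
  obtain ⟨v, ⟨hvZ, hvB⟩, rfl⟩ := hx
  exact ⟨v, hvZ, rfl, isPowerProduct_of_mem_elementaryBounded hws hvB⟩

theorem parikhVector_replicate_flatten (n : ℕ) (w : List α) :
    parikhVector (List.replicate n w).flatten = n • parikhVector w := by
  induction n with
  | zero => simp
  | succ n ih => rw [List.replicate_succ, List.flatten_cons, parikhVector_append, ih, succ_nsmul']

theorem exists_isPowerProduct_of_sum {Z : Language α} {s N : ℕ} {ι : Type}
    (l : List ι) (x : ι → α → ℕ) (t : ι → ℕ)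
    (h : ∀ i ∈ l, ∃ v ∈ Z ^ t i, parikhVector v = x i ∧ IsPowerProduct s N v) :
    ∃ v ∈ Z ^ (l.map t).sum, parikhVector v = (l.map x).sum ∧ IsPowerProduct (l.length * s) N v := by
  induction l with
  | nil => exact ⟨[], Language.nil_mem_one, by simp, .nil _ _⟩
  | cons i l ih =>
    obtain ⟨u, hu, hux, hpu⟩ := h i (by simp)
    obtain ⟨v, hv, hvx, hpv⟩ := ih fun j hj => h j (by simp [hj])
    refine ⟨u ++ v, ?_, by simp [hux, hvx], (hpu.append hpv).mono (by simp; ring_nf; rfl) le_rfl⟩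
    rw [List.map_cons, List.sum_cons, pow_add]
    exact ⟨u, hu, v, hv, rfl⟩

theorem HasParikhDecomposition.hasPowerProducts_pow [Fintype α] {Z : Language α} {K r N : ℕ}
    (hZ : HasParikhDecomposition Z K N) (hp : HasPowerProducts Z r N) (t : ℕ) :
    HasPowerProducts (Z ^ t) (K * (1 + r)) N := by
  classical
  obtain ⟨ι, _, cls, c, hcard, hcov, hsub, hc, hadd⟩ := hZ
  -- An element of the `t`-fold sumset is sorted by classes: `T i` summands come from the class `i`,
  -- and `X i` is their sum.
  have key : ∀ t, ∀ x ∈ parikhImage (Z ^ t), ∃ (T : ι → ℕ) (X : ι → α → ℕ),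
      ∑ i, T i = t ∧ ∑ i, X i = x ∧ ∀ i, X i ∈ collected (cls i) (c i) (T i) := by
    intro t
    induction t with
    | zero =>
      rintro _ ⟨w, hw, rfl⟩
      obtain rfl : w = [] := hw
      exact ⟨0, 0, by simp, by simp, fun i => rfl⟩
    | succ t ih =>
      intro x hx
      rw [pow_succ] at hx
      obtain ⟨y, hy, z, hz, rfl⟩ := mem_parikhImage_mul.1 hx
      obtain ⟨T, X, rfl, rfl, hX⟩ := ih y hy
      obtain ⟨j, hj⟩ := hcov z hz
      refine ⟨T + Pi.single j 1, X + Pi.single j z, ?_, ?_, fun i => ?_⟩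
      · simp [Finset.sum_add_distrib]
      · simp [Finset.sum_add_distrib]
      · by_cases hij : i = j
        · subst hij
          simpa using add_mem_collected (hadd i) (hX i) hj
        · simpa [hij] using hX i
  intro x hx
  obtain ⟨T, X, rfl, rfl, hX⟩ := key t x hx
  obtain ⟨v, hv, hvx, hpv⟩ := exists_isPowerProduct_of_sum (Z := Z) (s := 1 + r) (N := N)
    Finset.univ.toList X T (fun i _ => by
      have hi := hX i
      generalize T i = n at hi ⊢
      generalize X i = x at hi ⊢
      cases n with
      | zero =>
        obtain rfl : x = 0 := hi
        exact ⟨[], Language.nil_mem_one, rfl, .nil _ _⟩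
      | succ n =>
        obtain ⟨y, hy, rfl⟩ := hi
        obtain ⟨⟨w, hw, hwc⟩, hle⟩ := hc i ⟨y, hy⟩
        obtain ⟨v, hv, rfl, hpv⟩ := hp y (hsub i hy)
        rw [← hwc, sum_parikhVector] at hle
        refine ⟨(List.replicate n w).flatten ++ v, ?_, ?_,
          (isPowerProduct_replicate hle n).append hpv⟩
        · rw [pow_succ]
          exact ⟨_, replicate_flatten_mem_pow hw n, v, hv, rfl⟩
        · rw [parikhVector_append, parikhVector_replicate_flatten, hwc])
  rw [Finset.sum_map_toList] at hv hvx
  refine ⟨v, hv, hvx, hpv.mono ?_ le_rfl⟩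
  rw [Finset.length_toList, Finset.card_univ]
  exact Nat.mul_le_mul_right _ hcard

end PowerProduct

/-! ### Substitutions -/

namespace LangSubstitution

variable {α β : Type} (σ : LangSubstitution α β)

theorem apply_ofList_cons (a : α) (w : List α) :
    σ (FreeMonoid.ofList (a :: w)) = σ.onLetter a * σ (FreeMonoid.ofList w) := by
  rw [FreeMonoid.ofList_cons, map_mul]
  rfl

theorem apply_ofList_replicate_flatten (n : ℕ) (w : List α) :
    σ (FreeMonoid.ofList (List.replicate n w).flatten) = σ (FreeMonoid.ofList w) ^ n := by
  induction n with
  | zero => exact map_one σ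
  | succ n ih =>
    rw [List.replicate_succ, List.flatten_cons, FreeMonoid.ofList_append, map_mul, ih, pow_succ']

variable [DecidableEq β]

theorem parikhImage_apply_perm {u v : List α} (h : u.Perm v) :
    parikhImage (σ (FreeMonoid.ofList u)) = parikhImage (σ (FreeMonoid.ofList v)) := by
  induction h with
  | nil => rfl
  | cons a _ ih =>
    rw [apply_ofList_cons, apply_ofList_cons, parikhImage_congr_mul ih]
  | swap a b l =>
    ext x
    simp only [apply_ofList_cons, ← mul_assoc, mem_parikhImage_mul]
    constructor <;>
    · rintro ⟨_, ⟨y, hy, z, hz, rfl⟩, u, hu, rfl⟩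
      exact ⟨_, ⟨z, hz, y, hy, rfl⟩, u, hu, by rw [add_comm z y]⟩
  | trans _ _ ih₁ ih₂ => exact ih₁.trans ih₂

theorem hasParikhDecomposition_apply [Fintype β] {K N : ℕ}
    (h : ∀ a, HasParikhDecomposition (σ.onLetter a) K N) (w : List α) :
    HasParikhDecomposition (σ (FreeMonoid.ofList w)) (K ^ w.length) (w.length * N) := by
  induction w with
  | nil =>
    rw [FreeMonoid.ofList_nil, map_one]
    simpa using HasParikhDecomposition.one
  | cons a w ih =>
    rw [apply_ofList_cons, List.length_cons, pow_succ', add_mul, one_mul, add_comm]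
    exact (h a).mul ih

theorem hasPowerProducts_apply {r N : ℕ} (h : ∀ a, HasPowerProducts (σ.onLetter a) r N)
    (w : List α) : HasPowerProducts (σ (FreeMonoid.ofList w)) (w.length * r) N := by
  induction w with
  | nil =>
    rw [FreeMonoid.ofList_nil, map_one]
    exact .one _ _
  | cons a w ih =>
    rw [apply_ofList_cons, List.length_cons, add_mul, one_mul, add_comm]
    exact (h a).mul ih

theorem hasPowerProducts_apply_of_mem_elementaryBounded [Fintype β] {s K r N : ℕ} (hK : 1 ≤ K)
    (hdec : ∀ a, HasParikhDecomposition (σ.onLetter a) K N)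
    (hpow : ∀ a, HasPowerProducts (σ.onLetter a) r N) {ws : List (List α)}
    (hws : ∀ w ∈ ws, w.length ≤ s) {u : List α} (hu : u ∈ elementaryBounded ws) :
    HasPowerProducts (σ (FreeMonoid.ofList u)) (ws.length * (K ^ s * (1 + s * r)))
      ((s + 1) * N) := by
  induction ws generalizing u with
  | nil =>
    obtain rfl : u = [] := hu
    rw [FreeMonoid.ofList_nil, map_one]
    exact .one _ _
  | cons w ws ih =>
    rw [elementaryBounded_cons] at hu
    obtain ⟨x, hx, y, hy, rfl⟩ := hu
    obtain ⟨n, rfl⟩ := mem_kstar_singleton.1 hx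
    rw [FreeMonoid.ofList_append, map_mul, apply_ofList_replicate_flatten, List.length_cons,
      add_mul, one_mul, add_comm]
    have hw := hws w (by simp)
    refine HasPowerProducts.mul ?_ (ih (fun v hv => hws v (by simp [hv])) hy)
    refine HasParikhDecomposition.hasPowerProducts_pow ?_ ?_ n
    · exact (σ.hasParikhDecomposition_apply hdec w).mono (Nat.pow_le_pow_right hK hw)
        (Nat.mul_le_mul_right _ (hw.trans (Nat.le_succ s)))
    · exact (σ.hasPowerProducts_apply hpow w).mono (Nat.mul_le_mul_right _ hw)
        (Nat.le_mul_of_pos_left _ (Nat.succ_pos s))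

theorem hasPowerProducts_onLanguage [DecidableEq α] {L : Language α} {r N : ℕ}
    {ws : List (List α)} (hL : parikhImage (L ⊓ elementaryBounded ws) = parikhImage L)
    (h : ∀ u ∈ elementaryBounded ws, HasPowerProducts (σ (FreeMonoid.ofList u)) r N) :
    HasPowerProducts (σ.onLanguage L) r N := by
  rintro _ ⟨v, ⟨u, hu, hv⟩, rfl⟩
  have hmem : parikhVector u ∈ parikhImage (L ⊓ elementaryBounded ws) := hL ▸ ⟨u, hu, rfl⟩
  obtain ⟨u', ⟨hu'L, hu'B⟩, huu'⟩ := hmem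
  have hv' : parikhVector v ∈ parikhImage (σ (FreeMonoid.ofList u')) := by
    rw [σ.parikhImage_apply_perm (perm_of_parikhVector_eq huu')]
    exact ⟨v, hv, rfl⟩
  obtain ⟨v', hv', hvv', hp⟩ := h u' hu'B _ hv'
  exact ⟨v', ⟨u', hu'L, hv'⟩, hvv', hp⟩

end LangSubstitution

/-! ### The computable function -/

/-- All words of length at most `n` over the letters in `l`. -/
def wordsUpTo {β : Type} (l : List β) (n : ℕ) : List (List β) :=
  n.rec [[]] fun _ ws => [] :: l.flatMap fun a => ws.map (a :: ·)

theorem mem_wordsUpTo {β : Type} {l : List β} (hl : ∀ a, a ∈ l) {n : ℕ} {w : List β}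
    (hw : w.length ≤ n) : w ∈ wordsUpTo l n := by
  induction n generalizing w with
  | zero => simp [wordsUpTo, List.length_eq_zero_iff.1 (Nat.le_zero.1 hw)]
  | succ n ih =>
    cases w with
    | nil => exact List.mem_cons_self
    | cons a w =>
      exact List.mem_cons_of_mem _ (List.mem_flatMap.2
        ⟨a, hl a, List.mem_map_of_mem (ih (by simpa using hw))⟩)

theorem HasPowerProducts.parikhImage_inf_eq {β : Type} [DecidableEq β] {Z : Language β} {r N : ℕ}
    (h : HasPowerProducts Z r N) {ws : List (List β)} (hws : ∀ w : List β, w.length ≤ N → w ∈ ws) :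
    parikhImage (Z ⊓ elementaryBounded (List.replicate r ws).flatten) = parikhImage Z := by
  refine Set.Subset.antisymm ?_ fun y hy => ?_
  · rintro _ ⟨w, hw, rfl⟩
    exact ⟨w, hw.1, rfl⟩
  · obtain ⟨v, hv, hvy, hp⟩ := h y hy
    exact ⟨v, ⟨hv, hp.mem_elementaryBounded hws⟩, hvy⟩

theorem wordsUpTo_map {β γ : Type} (f : β → γ) (l : List β) (n : ℕ) :
    wordsUpTo (l.map f) n = (wordsUpTo l n).map (List.map f) := by
  induction n with
  | zero => rfl
  | succ n ih =>
    change [] :: (l.map f).flatMap (fun b => (wordsUpTo (l.map f) n).map (b :: ·)) =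
      ([] :: l.flatMap fun a => (wordsUpTo l n).map (a :: ·)).map (List.map f)
    simp [ih, List.flatMap_map, List.map_flatMap, Function.comp_def]

/-- A bound for the lengths of the constants in the decomposition of the Parikh image of a grammar
with at most `s` productions, each with a right-hand side of length at most `s`. The summand `s`
covers the words that present the bounded languages of the letters. -/
def constantBound (s : ℕ) : ℕ := (s + 1) ^ (s * 2 ^ s) + s

/-- A bound for the number of classes in the decomposition of the Parikh image of such a grammar
over at most `s` letters. -/
def classBound (s : ℕ) : ℕ := (constantBound s + 1) ^ s * 2 ^ s

/-- A bound for the number of powers needed in a product, if `s` bounds all parts of the data. -/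
def powerBound (s : ℕ) : ℕ := s * (classBound s ^ s * (1 + s * s))

/-- All words up to a length bound computed from the encoding of the data, listed sufficiently many
times over. -/
def boundingWords (x : SubstInput) : List (List ℕ) :=
  (List.replicate (powerBound (Encodable.encode x))
    (wordsUpTo (List.range x.2.1)
      ((Encodable.encode x + 1) * constantBound (Encodable.encode x)))).flatten

theorem primrec_nat_pow : Primrec₂ ((· ^ ·) : ℕ → ℕ → ℕ) :=
  Primrec₂.unpaired'.1 Nat.Primrec.pow

theorem primrec_constantBound : Primrec constantBound :=
  Primrec.nat_add.comp (primrec_nat_pow.comp Primrec.succ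
    (Primrec.nat_mul.comp .id (primrec_nat_pow.comp (.const 2) .id))) .id

theorem primrec_classBound : Primrec classBound :=
  Primrec.nat_mul.comp (primrec_nat_pow.comp (Primrec.succ.comp primrec_constantBound) .id)
    (primrec_nat_pow.comp (.const 2) .id)

theorem primrec_powerBound : Primrec powerBound :=
  Primrec.nat_mul.comp .id (Primrec.nat_mul.comp (primrec_nat_pow.comp primrec_classBound .id)
    (Primrec.nat_add.comp (.const 1) (Primrec.nat_mul.comp .id .id)))

theorem primrec_wordsUpTo : Primrec₂ (wordsUpTo : List ℕ → ℕ → List (List ℕ)) := by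
  refine Primrec.nat_rec (f := fun _ : List ℕ => [[]])
    (g := fun l p => [] :: l.flatMap fun a => p.2.map (a :: ·)) (.const _) ?_
  refine Primrec.list_cons.comp (.const []) (Primrec.list_flatMap .fst ?_)
  refine Primrec.list_map (Primrec.snd.comp (Primrec.snd.comp .fst)) ?_
  exact Primrec.list_cons.comp (Primrec.snd.comp .fst) .snd

theorem primrec_replicate_flatten :
    Primrec₂ fun (n : ℕ) (l : List (List ℕ)) => (List.replicate n l).flatten := by
  have h : Primrec fun p : ℕ × List (List ℕ) => (List.range p.1).flatMap fun _ => p.2 :=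
    Primrec.list_flatMap (Primrec.list_range.comp .fst) (Primrec.snd.comp .fst)
  refine h.of_eq fun p => ?_
  rw [List.flatMap_def, List.map_const', List.length_range]

theorem primrec_boundingWords : Primrec boundingWords :=
  primrec_replicate_flatten.comp (primrec_powerBound.comp .encode)
    (primrec_wordsUpTo.comp (Primrec.list_range.comp (Primrec.fst.comp .snd))
      (Primrec.nat_mul.comp (Primrec.succ.comp .encode) (primrec_constantBound.comp .encode)))

section Encode

variable {β γ : Type} [Encodable β] [Encodable γ]

theorem encode_fst_le (x : β × γ) : Encodable.encode x.1 ≤ Encodable.encode x :=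
  Nat.left_le_pair _ _

theorem encode_snd_le (x : β × γ) : Encodable.encode x.2 ≤ Encodable.encode x :=
  Nat.right_le_pair _ _

theorem encode_le_of_mem {l : List β} {b : β} (h : b ∈ l) :
    Encodable.encode b ≤ Encodable.encode l := by
  induction l with
  | nil => simp at h
  | cons c l ih =>
    rw [Encodable.encode_list_cons]
    rcases List.mem_cons.1 h with rfl | h
    · exact (Nat.left_le_pair _ _).trans (Nat.le_succ _)
    · exact (ih h).trans ((Nat.right_le_pair _ _).trans (Nat.le_succ _))

end Encode

theorem length_le_encode_of_mem_wordsCode {n : ℕ} {ws : List (List (Fin n))} {w : List (Fin n)}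
    (hw : w ∈ ws) : w.length ≤ Encodable.encode (wordsCode ws) := by
  have h := encode_le_of_mem (List.mem_map_of_mem (f := List.map Fin.val) hw)
  have h' := Encodable.length_le_encode (w.map Fin.val)
  rw [List.length_map] at h'
  exact h'.trans h

theorem length_le_encode_wordsCode {n : ℕ} (ws : List (List (Fin n))) :
    ws.length ≤ Encodable.encode (wordsCode ws) := by
  have h := Encodable.length_le_encode (wordsCode ws)
  rwa [wordsCode, List.length_map] at h

namespace GrammarCode

theorem card_rules_le_encode {n : ℕ} (g : GrammarCode (Fin n)) :
    g.ruleSet.card ≤ Encodable.encode (g.mapTerminals Fin.val) := by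
  have h1 : g.ruleSet.card ≤ g.2.length :=
    (List.toFinset_card_le _).trans (by rw [List.length_map])
  have h2 := Encodable.length_le_encode (g.mapTerminals Fin.val).2
  rw [mapTerminals, List.length_map] at h2
  exact h1.trans (h2.trans (encode_snd_le _))

theorem length_output_le_encode {n : ℕ} (g : GrammarCode (Fin n)) {r}
    (hr : r ∈ g.ruleSet) : r.output.length ≤ Encodable.encode (g.mapTerminals Fin.val) := by
  obtain ⟨⟨X, w⟩, hw, rfl⟩ := List.mem_map.1 (List.mem_toFinset.1 hr)
  have h1 := encode_le_of_mem
    (List.mem_map_of_mem (f := fun r => (r.1, r.2.map (Sum.map Fin.val id))) hw)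
  have h2 := Encodable.length_le_encode (w.map (Sum.map Fin.val id : Fin n ⊕ ℕ → ℕ ⊕ ℕ))
  rw [List.length_map] at h2
  change (w.map toSymbol).length ≤ _
  rw [List.length_map]
  exact h2.trans ((encode_snd_le (X, w.map (Sum.map Fin.val id : Fin n ⊕ ℕ → ℕ ⊕ ℕ))).trans
    (h1.trans (encode_snd_le (g.mapTerminals Fin.val))))

theorem hasParikhDecomposition_language {n s : ℕ} (g : GrammarCode (Fin n)) (hn : n ≤ s)
    (hs : Encodable.encode (g.mapTerminals Fin.val) ≤ s) :
    HasParikhDecomposition g.language (classBound s) (constantBound s) := by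
  have h := g.toCFG.hasParikhDecomposition (d := s + 1) (m := s) (N := constantBound s)
    (fun r hr => ((g.length_output_le_encode hr).trans hs).trans (Nat.le_succ s))
    (Nat.succ_pos s) (g.card_rules_le_encode.trans hs) (Nat.le_add_right _ _)
  refine h.mono ?_ le_rfl
  rw [Fintype.card_fin]
  exact Nat.mul_le_mul_right _ (Nat.pow_le_pow_right (Nat.succ_pos _) hn)

end GrammarCode

/-- There is one total computable function `F` which, from the two alphabet sizes, a grammar of `L`,
the words of `B`, and grammars for the `σ(a)` and words for the `τ(a)`, computes the words of an
elementary bounded language `B'` with `Π(σ(L) ∩ B') = Π(σ(L))`. -/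
theorem mainTheorem3 :
    ∃ F : SubstInput → List (List ℕ), Computable F ∧
      ∀ (p q : ℕ) (L B : Language (Fin p)) (σ τ : LangSubstitution (Fin p) (Fin q))
        (g : GrammarCode (Fin p)) (ws : List (List (Fin p)))
        (gs : Fin p → GrammarCode (Fin q)) (ts : Fin p → List (List (Fin q))),
        L = g.language →
        B = elementaryBounded ws →
        (∀ a, σ.onLetter a = (gs a).language) →
        (∀ a, τ.onLetter a = elementaryBounded (ts a)) →
        parikhImage (L ⊓ B) = parikhImage L →
        (∀ a, parikhImage (σ.onLetter a ⊓ τ.onLetter a) = parikhImage (σ.onLetter a)) →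
        ∃ ws' : List (List (Fin q)),
          F (substInput g ws gs ts) = wordsCode ws' ∧
          parikhImage (σ.onLanguage L ⊓ elementaryBounded ws') =
            parikhImage (σ.onLanguage L) := by
  refine ⟨boundingWords, primrec_boundingWords.to_comp, ?_⟩
  rintro p q L B σ τ g ws gs ts - rfl hσ hτ hL hστ
  set x := substInput g ws gs ts with hx
  -- The code number of the data bounds the code numbers of all their parts, and hence all lengths
  -- of lists in them.
  set s := Encodable.encode x with hs
  have h1 : Encodable.encode x.2 ≤ s := encode_snd_le x
  have h2 : Encodable.encode x.2.2 ≤ s := (encode_snd_le x.2).trans h1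
  have h3 : Encodable.encode x.2.2.2 ≤ s := (encode_snd_le x.2.2).trans h2
  have h4 : Encodable.encode x.2.2.2.2 ≤ s := (encode_snd_le x.2.2.2).trans h3
  have hq : q ≤ s := (encode_fst_le x.2).trans h1
  have hws : Encodable.encode (wordsCode ws) ≤ s := (encode_fst_le x.2.2.2).trans h3
  have hgs : ∀ a, Encodable.encode ((gs a).mapTerminals Fin.val) ≤ s := fun a =>
    (encode_le_of_mem (List.mem_ofFn.2 ⟨a, rfl⟩)).trans ((encode_fst_le x.2.2.2.2).trans h4)
  have hts : ∀ a, Encodable.encode (wordsCode (ts a)) ≤ s := fun a =>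
    (encode_le_of_mem (List.mem_ofFn.2 ⟨a, rfl⟩)).trans ((encode_snd_le x.2.2.2.2).trans h4)
  have hdec : ∀ a, HasParikhDecomposition (σ.onLetter a) (classBound s) (constantBound s) := by
    intro a
    rw [hσ a]
    exact (gs a).hasParikhDecomposition_language hq (hgs a)
  have hpow : ∀ a, HasPowerProducts (σ.onLetter a) s (constantBound s) := by
    intro a
    have h := hστ a
    rw [hτ a] at h
    exact (hasPowerProducts_of_elementaryBounded
      (fun w hw => (length_le_encode_of_mem_wordsCode hw).trans (hts a)) h).mono
      ((length_le_encode_wordsCode _).trans (hts a)) (Nat.le_add_left _ _)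
  have hmain : HasPowerProducts (σ.onLanguage L) (powerBound s) ((s + 1) * constantBound s) :=
    σ.hasPowerProducts_onLanguage hL fun u hu =>
      (σ.hasPowerProducts_apply_of_mem_elementaryBounded
        (Nat.mul_pos (pow_pos (Nat.succ_pos _) _) (pow_pos two_pos _)) hdec hpow
        (fun w hw => (length_le_encode_of_mem_wordsCode hw).trans hws) hu).mono
      (Nat.mul_le_mul_right _ ((length_le_encode_wordsCode _).trans hws)) le_rfl
  refine ⟨(List.replicate (powerBound s)
    (wordsUpTo (List.finRange q) ((s + 1) * constantBound s))).flatten, ?_, ?_⟩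
  · have hrange : List.range q = (List.finRange q).map Fin.val := by simp
    change (List.replicate (powerBound s)
      (wordsUpTo (List.range q) ((s + 1) * constantBound s))).flatten = _
    rw [hrange, wordsUpTo_map, wordsCode, List.map_flatten, List.map_replicate]
  · exact hmain.parikhImage_inf_eq fun w hw => mem_wordsUpTo List.mem_finRange hw
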